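/- Let $\{B(t),\,t\ge 0\}$ be a standard Brownian motion (with almost surely continuous sample paths), let $\varphi(x)=\frac{1}{\sqrt{2\pi}}e^{-x^2/2}$ be the density of the standard normal distribution $N(0,1)$, and let $\Psi(x)=\int_x^\infty \varphi(s)\,ds$ be its tail distribution function. For $c,y>0$ put $$K_{c,y}=\frac{2\,\varphi(c\sqrt{y})}{\sqrt{y}}-2c\,\Psi(c\sqrt{y}).$$ Then for any $c>0$ and any two constants $T_2>T_1>0$, we have $K_{c,y}>0$ for all $y>0$, and $$\mathbb{P}\Bigl(\inf_{t\in[T_1,T_2]}\bigl(B(t)-ct\bigr)>u\Bigr)= K_{c,T_2-T_1}\,\frac{T_1}{u}\,\Psi\Bigl(\frac{u+cT_1}{\sqrt{T_1}}\Bigr)(1+o(1)),\qquad u\to\infty.$$ -/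

import Mathlib

open MeasureTheory ProbabilityTheory Filter Asymptotics
open scoped NNReal

/-- The density `φ` of the standard normal law `N(0,1)`. -/
noncomputable def stdNormalDensity (x : ℝ) : ℝ := gaussianPDFReal 0 1 x

/-- The tail distribution function `Ψ(x) = P(N > x)` of a standard normal variable `N`. -/
noncomputable def stdNormalTail (x : ℝ) : ℝ := (gaussianReal 0 1).real (Set.Ioi x)

/-- The constant `K_{c,y} = 2 φ(c √y) / √y - 2 c Ψ(c √y)`. -/
noncomputable def constK (c y : ℝ) : ℝ :=
  2 * stdNormalDensity (c * √y) * (1 / √y) - 2 * c * stdNormalTail (c * √y)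

open Set Topology

/-! Write `t = T₁ + s`. The infimum equals `(B(T₁) - c T₁) - M`, where `M` is the maximum over `[0,
T₂ - T₁]` of `c s + W(s)` and `W(s) = -(B(T₁ + s) - B(T₁))` is a Brownian motion independent of
`B(T₁)`. The probability is therefore the integral of the density of `B(T₁) - c T₁` at `z + u`
against `F(z) = P(M < z)`.

With `a = (u + c T₁) / T₁`, that density is `φ((u + c T₁)/√T₁)/√T₁` times `exp(-a z - z²/(2 T₁))`,
so only small `z` matter (`gaussianPDFReal_neg_mul_add`). The law of `M`
(`measureReal_max_drift_lt`) gives `F(z) = K z + o(z)` as `z ↓ 0`, the Abelian lemma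
`tendsto_pow_mul_integral_exp_neg_mul` gives `K / a²` for the integral, and Mills' ratio turns `φ`
into `Ψ`.

The law of `M` comes from a reflection principle on finite grids: after the first passage of `x` the
increment is reflected, at the cost of a likelihood ratio. Refining the grid makes the overshoot
vanish. -/

/-! ### Gaussian densities and their reflection -/

lemma gaussianReal_real_eq_integral (m : ℝ) {v : ℝ≥0} (hv : v ≠ 0) (s : Set ℝ) :
    (gaussianReal m v).real s = ∫ x in s, gaussianPDFReal m v x := by
  rw [measureReal_def, gaussianReal_apply_eq_integral m hv, ENNReal.toReal_ofReal]
  exact integral_nonneg fun x ↦ gaussianPDFReal_nonneg m v x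

lemma continuous_gaussianPDFReal (m : ℝ) (v : ℝ≥0) : Continuous (gaussianPDFReal m v) := by
  rw [gaussianPDFReal_def]
  fun_prop

/-- Reflecting a Gaussian variable with mean `c s` and variance `s` about the origin changes its
density by the factor `exp (-2 c y)`. -/
lemma gaussianPDFReal_drift_neg (c : ℝ) (s : ℝ≥0) (y : ℝ) :
    gaussianPDFReal (c * s) s (-y) = gaussianPDFReal (c * s) s y * Real.exp (-(2 * c * y)) := by
  rcases eq_or_ne s 0 with rfl | hs
  · simp
  · have hs' : (s : ℝ) ≠ 0 := by exact_mod_cast hs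
    simp only [gaussianPDFReal_def]
    rw [mul_assoc (√(2 * Real.pi * s))⁻¹, ← Real.exp_add]
    congr 2
    field_simp
    ring

/-- Zero variance is included because passage at the last index leaves a zero increment to reflect.
-/
lemma lintegral_gaussianReal_drift_neg (c : ℝ) (s : ℝ≥0) {f : ℝ → ENNReal} (hf : Measurable f) :
    ∫⁻ y, f y ∂gaussianReal (c * s) s
      = ∫⁻ y, f (-y) * ENNReal.ofReal (Real.exp (-(2 * c * y))) ∂gaussianReal (c * s) s := by
  rcases eq_or_ne s 0 with rfl | hs
  · simp [gaussianReal_zero_var, lintegral_dirac]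
  · rw [gaussianReal_of_var_ne_zero _ hs,
      lintegral_withDensity_eq_lintegral_mul _ (measurable_gaussianPDF _ _) hf,
      lintegral_withDensity_eq_lintegral_mul _ (measurable_gaussianPDF _ _) (by fun_prop),
      ← lintegral_neg_eq_self]
    refine lintegral_congr fun y ↦ ?_
    simp only [Pi.mul_apply, gaussianPDF, gaussianPDFReal_drift_neg]
    rw [ENNReal.ofReal_mul (gaussianPDFReal_nonneg _ _ _)]
    ring

lemma hasDerivAt_gaussianReal_real_Iio (m : ℝ) {v : ℝ≥0} (hv : v ≠ 0) (x : ℝ) :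
    HasDerivAt (fun x ↦ (gaussianReal m v).real (Iio x)) (gaussianPDFReal m v x) x := by
  have h : (fun x ↦ (gaussianReal m v).real (Iio x))
      = fun x ↦ (gaussianReal m v).real (Iio 0) + ∫ y in (0 : ℝ)..x, gaussianPDFReal m v y := by
    funext x
    simp only [gaussianReal_real_eq_integral m hv, ← integral_Iic_eq_integral_Iio]
    rw [← intervalIntegral.integral_Iic_sub_Iic (integrable_gaussianPDFReal m v).integrableOn
      (integrable_gaussianPDFReal m v).integrableOn]
    ring
  rw [h]
  exact (((continuous_gaussianPDFReal m v).integral_hasStrictDerivAt 0 x).hasDerivAt).const_add _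

lemma gaussianReal_real_Iio_zero (c : ℝ) {v : ℝ≥0} (hv : v ≠ 0) :
    (gaussianReal (c * v) v).real (Iio 0) = stdNormalTail (c * √(v : ℝ)) := by
  have hv' : (0 : ℝ) < v := by positivity
  have hs : (0 : ℝ) < √(v : ℝ) := Real.sqrt_pos.2 hv'
  -- The negative slope sends the upper tail of the standard normal directly to the lower tail.
  have h1 : (gaussianReal 0 1).map (fun x ↦ c * v + -√(v : ℝ) * x) = gaussianReal (c * v) v := by
    have : (fun x ↦ c * v + -√(v : ℝ) * x) = (fun x ↦ c * v + x) ∘ (fun x ↦ -√(v : ℝ) * x) := rfl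
    rw [this, ← Measure.map_map (by fun_prop) (by fun_prop), gaussianReal_map_const_mul,
      gaussianReal_map_const_add]
    congr 1
    · simp
    · ext
      simp
  rw [← h1, measureReal_def, Measure.map_apply (by fun_prop) measurableSet_Iio, stdNormalTail,
    measureReal_def]
  congr 2
  ext x
  simp only [mem_preimage, mem_Iio, mem_Ioi]
  have h2 : c * v + -√(v : ℝ) * x = √(v : ℝ) * (c * √(v : ℝ) - x) := by
    have := Real.mul_self_sqrt hv'.le
    linear_combination (-c) * this
  rw [h2, mul_neg_iff]
  constructor
  · rintro (h | h) <;> linarith [h.1, h.2]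
  · intro h
    left
    exact ⟨hs, by linarith⟩

lemma gaussianPDFReal_drift_zero (c : ℝ) {v : ℝ≥0} (hv : v ≠ 0) :
    gaussianPDFReal (c * v) v 0 = stdNormalDensity (c * √(v : ℝ)) * (1 / √(v : ℝ)) := by
  have hv' : (0 : ℝ) < v := by positivity
  have hs : (0 : ℝ) < √(v : ℝ) := Real.sqrt_pos.2 hv'
  simp only [stdNormalDensity, gaussianPDFReal_def, NNReal.coe_one, mul_one, sub_zero]
  rw [Real.sqrt_mul (by positivity) (v : ℝ), mul_inv, mul_right_comm, one_div]
  congr 3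
  rw [mul_pow, Real.sq_sqrt hv'.le]
  field_simp
  ring

/-! ### The standard normal tail and positivity of `K` -/

lemma hasDerivAt_stdNormalDensity (x : ℝ) :
    HasDerivAt stdNormalDensity (-(x * stdNormalDensity x)) x := by
  have h : stdNormalDensity = fun x ↦ (√(2 * Real.pi))⁻¹ * Real.exp (-x ^ 2 / 2) := by
    funext x
    simp [stdNormalDensity, gaussianPDFReal_def]
  rw [h]
  have h1 : HasDerivAt (fun x : ℝ ↦ -x ^ 2 / 2) (-x) x := by
    have := ((hasDerivAt_pow 2 x).neg).div_const 2
    refine this.congr_deriv ?_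
    simp
    ring
  refine (h1.exp.const_mul _).congr_deriv ?_
  ring

lemma tendsto_stdNormalDensity_atTop : Tendsto stdNormalDensity atTop (𝓝 0) := by
  have h : stdNormalDensity = fun x ↦ (√(2 * Real.pi))⁻¹ * Real.exp (-(x ^ 2 / 2)) := by
    funext x
    simp [stdNormalDensity, gaussianPDFReal_def, neg_div]
  rw [h, ← mul_zero (√(2 * Real.pi))⁻¹]
  refine (Real.tendsto_exp_neg_atTop_nhds_zero.comp ?_).const_mul _
  exact (tendsto_pow_atTop two_ne_zero).atTop_div_const two_pos

lemma stdNormalDensity_pos (x : ℝ) : 0 < stdNormalDensity x :=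
  gaussianPDFReal_pos 0 1 x one_ne_zero

lemma stdNormalTail_eq_integral (x : ℝ) :
    stdNormalTail x = ∫ y in Ioi x, stdNormalDensity y :=
  gaussianReal_real_eq_integral 0 one_ne_zero _

lemma stdNormalTail_pos (x : ℝ) : 0 < stdNormalTail x := by
  rw [stdNormalTail_eq_integral, setIntegral_pos_iff_support_of_nonneg_ae
    (Eventually.of_forall fun y ↦ (stdNormalDensity_pos y).le)
    (integrable_gaussianPDFReal 0 1).integrableOn]
  refine lt_of_lt_of_le (?_ : 0 < volume (Ioi x))
    (measure_mono fun y hy ↦ ⟨(stdNormalDensity_pos y).ne', hy⟩)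
  simp

/-- Since `φ' = -y φ`, `φ(x)` is the integral of `y φ(y)` over `y > x`, where `y` exceeds `x`. -/
lemma mul_stdNormalTail_lt {x : ℝ} (hx : 0 < x) : x * stdNormalTail x < stdNormalDensity x := by
  have hd : ∀ y ∈ Ioi x, HasDerivAt (fun y ↦ -stdNormalDensity y) (y * stdNormalDensity y) y :=
    fun y _ ↦ by simpa using (hasDerivAt_stdNormalDensity y).fun_neg
  have hc : ContinuousWithinAt (fun y ↦ -stdNormalDensity y) (Ici x) x :=
    (hasDerivAt_stdNormalDensity x).continuousAt.neg.continuousWithinAt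
  have hl : Tendsto (fun y ↦ -stdNormalDensity y) atTop (𝓝 0) := by
    simpa using tendsto_stdNormalDensity_atTop.neg
  have hi : IntegrableOn (fun y ↦ y * stdNormalDensity y) (Ioi x) :=
    integrableOn_Ioi_deriv_of_nonneg hc hd
      (fun y hy ↦ mul_nonneg (hx.le.trans (le_of_lt hy)) (stdNormalDensity_pos y).le) hl
  have h1 := integral_Ioi_of_hasDerivAt_of_tendsto hc hd hi hl
  have hi2 : IntegrableOn (fun y ↦ x * stdNormalDensity y) (Ioi x) :=
    ((integrable_gaussianPDFReal 0 1).const_mul x).integrableOn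
  have hi3 : IntegrableOn (fun y ↦ y * stdNormalDensity y - x * stdNormalDensity y) (Ioi x) :=
    hi.sub hi2
  have h2 : 0 < ∫ y in Ioi x, (y * stdNormalDensity y - x * stdNormalDensity y) := by
    rw [setIntegral_pos_iff_support_of_nonneg_ae _ hi3]
    · refine lt_of_lt_of_le (?_ : 0 < volume (Ioi x)) (measure_mono fun y hy ↦ ⟨?_, hy⟩)
      · simp
      · rw [Function.mem_support, ← sub_mul]
        exact (mul_pos (sub_pos.2 hy) (stdNormalDensity_pos y)).ne'
    · filter_upwards [ae_restrict_mem measurableSet_Ioi] with y hy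
      rw [← sub_mul]
      exact (mul_pos (sub_pos.2 hy) (stdNormalDensity_pos y)).le
  rw [integral_sub hi hi2, h1, integral_const_mul, ← stdNormalTail_eq_integral] at h2
  linarith

lemma constK_pos {c y : ℝ} (hc : 0 < c) (hy : 0 < y) : 0 < constK c y := by
  have hs : 0 < √y := Real.sqrt_pos.2 hy
  have h := mul_stdNormalTail_lt (mul_pos hc hs)
  have : constK c y = 2 / √y * (stdNormalDensity (c * √y) - c * √y * stdNormalTail (c * √y)) := by
    rw [constK]
    field_simp
  rw [this]
  exact mul_pos (by positivity) (sub_pos.2 h)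

/-! ### Laplace-type asymptotics -/

/-- An Abelian theorem for the Laplace transform, with an additional Gaussian factor. -/
lemma tendsto_pow_mul_integral_exp_neg_mul {T C L : ℝ} (hT : 0 < T) (j : ℕ) {H : ℝ → ℝ}
    (hH : Measurable H) (hC : ∀ z, 0 < z → |H z| ≤ C * z ^ j)
    (hL : Tendsto (fun z ↦ H z / z ^ j) (𝓝[>] 0) (𝓝 L)) :
    Tendsto (fun a : ℝ ↦ a ^ (j + 1) *
      ∫ z in Ioi (0 : ℝ), Real.exp (-(a * z) - z ^ 2 / (2 * T)) * H z) atTop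
      (𝓝 (L * j.factorial)) := by
  have hgam : ∫ w in Ioi (0 : ℝ), Real.exp (-w) * w ^ j = j.factorial := by
    rw [← Real.Gamma_nat_eq_factorial, Real.Gamma_eq_integral (by positivity)]
    simp
  have hgi : IntegrableOn (fun w : ℝ ↦ Real.exp (-w) * w ^ j) (Ioi 0) := by
    have := Real.GammaIntegral_convergent (s := j + 1) (by positivity)
    simpa using this
  -- This is the integral after `z = w / a`: the Gaussian factor tends to `1` and `a ^ j * H (w /
  -- a)` to `L * w ^ j`, dominated by `C * exp (-w) * w ^ j`.
  have hmain : Tendsto (fun a : ℝ ↦ ∫ w in Ioi (0 : ℝ),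
      Real.exp (-w - (a⁻¹ * w) ^ 2 / (2 * T)) * (a ^ j * H (a⁻¹ * w))) atTop
      (𝓝 (∫ w in Ioi (0 : ℝ), L * (Real.exp (-w) * w ^ j))) := by
    refine tendsto_integral_filter_of_dominated_convergence
      (fun w ↦ C * (Real.exp (-w) * w ^ j)) ?_ ?_ (hgi.const_mul C) ?_
    · refine Eventually.of_forall fun a ↦ Measurable.aestronglyMeasurable ?_
      have : Measurable fun w ↦ H (a⁻¹ * w) := hH.comp (by fun_prop)
      fun_prop
    · filter_upwards [eventually_gt_atTop 0] with a ha
      filter_upwards [ae_restrict_mem measurableSet_Ioi] with w hw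
      have hw0 : (0 : ℝ) < w := hw
      rw [norm_mul, norm_mul, Real.norm_eq_abs, Real.abs_exp, Real.norm_eq_abs, Real.norm_eq_abs,
        abs_of_pos (pow_pos ha j)]
      have h1 : Real.exp (-w - (a⁻¹ * w) ^ 2 / (2 * T)) ≤ Real.exp (-w) := by
        apply Real.exp_le_exp.2
        have : 0 ≤ (a⁻¹ * w) ^ 2 / (2 * T) := by positivity
        linarith
      have h2 : a ^ j * |H (a⁻¹ * w)| ≤ C * w ^ j := by
        refine (mul_le_mul_of_nonneg_left (hC _ (by positivity)) (by positivity)).trans_eq ?_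
        rw [mul_pow, inv_pow]
        field_simp
      calc _ ≤ Real.exp (-w) * (C * w ^ j) :=
            mul_le_mul h1 h2 (by positivity) (Real.exp_pos _).le
        _ = _ := by ring
    · filter_upwards [ae_restrict_mem measurableSet_Ioi] with w hw
      have hw0 : (0 : ℝ) < w := hw
      have hz : Tendsto (fun a : ℝ ↦ a⁻¹ * w) atTop (𝓝 0) := by
        simpa using tendsto_inv_atTop_zero.mul_const w
      have hz' : Tendsto (fun a : ℝ ↦ a⁻¹ * w) atTop (𝓝[>] 0) := by
        rw [tendsto_nhdsWithin_iff]
        refine ⟨hz, ?_⟩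
        filter_upwards [eventually_gt_atTop 0] with a ha
        exact mul_pos (inv_pos.2 ha) hw0
      have h1 : Tendsto (fun a : ℝ ↦ Real.exp (-w - (a⁻¹ * w) ^ 2 / (2 * T))) atTop
          (𝓝 (Real.exp (-w))) := by
        refine (Real.continuous_exp.tendsto _).comp ?_
        simpa using ((hz.pow 2).div_const (2 * T)).const_sub (-w)
      have h2 : Tendsto (fun a : ℝ ↦ a ^ j * H (a⁻¹ * w)) atTop (𝓝 (L * w ^ j)) := by
        refine ((hL.comp hz').mul_const (w ^ j)).congr' ?_
        filter_upwards [eventually_gt_atTop 0] with a ha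
        simp only [Function.comp_apply, mul_pow, inv_pow]
        field_simp
      convert h1.mul h2 using 2
      ring
  rw [integral_const_mul, hgam] at hmain
  refine hmain.congr' ?_
  filter_upwards [eventually_gt_atTop 0] with a ha
  have h := integral_comp_mul_left_Ioi
    (fun z ↦ Real.exp (-(a * z) - z ^ 2 / (2 * T)) * H z) 0 (inv_pos.2 ha)
  rw [mul_zero, inv_inv, smul_eq_mul] at h
  rw [pow_succ, mul_assoc, ← h, ← integral_const_mul]
  refine integral_congr_ae (Eventually.of_forall fun w ↦ ?_)
  simp only [mul_inv_cancel_left₀ ha.ne']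
  ring

/-- Mills' ratio asymptotics. -/
lemma tendsto_mul_stdNormalTail_div :
    Tendsto (fun a ↦ a * stdNormalTail a / stdNormalDensity a) atTop (𝓝 1) := by
  -- Shifting by `a` gives `Ψ(a)/φ(a)` as the integral of `exp(-a z - z²/2)` over `z > 0`.
  have h := tendsto_pow_mul_integral_exp_neg_mul (T := 1) (C := 1) (L := 1) one_pos 0
    (H := fun _ ↦ 1) measurable_const (by simp) (by simp)
  simp only [zero_add, pow_one, mul_one, Nat.factorial_zero, Nat.cast_one] at h
  refine h.congr fun a ↦ ?_
  rw [mul_div_assoc]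
  congr 1
  rw [eq_div_iff (stdNormalDensity_pos a).ne', stdNormalTail_eq_integral, ← integral_mul_const]
  have h2 := (measurePreserving_add_right volume a).setIntegral_preimage_emb
    (MeasurableEquiv.addRight a).measurableEmbedding stdNormalDensity (Ioi a)
  rw [← h2]
  have : (fun x ↦ x + a) ⁻¹' Ioi a = Ioi 0 := by ext; simp
  rw [this]
  refine integral_congr_ae (Eventually.of_forall fun w ↦ ?_)
  simp only [stdNormalDensity, gaussianPDFReal_def, NNReal.coe_one, mul_one, sub_zero]
  rw [mul_left_comm, ← Real.exp_add]
  congr 2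
  ring

/-! ### Reflection principle at finitely many times -/

/-- By independence, `Y` can be reflected with `V` frozen. In use, `V` is the path stopped at an
index and `Y` the increment from there to the end. -/
lemma ProbabilityTheory.IndepFun.measure_lt_comp_eq_lintegral_reflection
    {Ω E : Type*} [MeasurableSpace Ω] [MeasurableSpace E] {P : Measure Ω} [IsProbabilityMeasure P]
    {V : Ω → E} {Y : Ω → ℝ} {c : ℝ} {s : ℝ≥0} (hVY : IndepFun V Y P) (hV : AEMeasurable V P)
    (hY : HasLaw Y (gaussianReal (c * s) s) P) {A : Set E} (hA : MeasurableSet A)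
    {f : E → ℝ} (hf : Measurable f) :
    P {ω | V ω ∈ A ∧ Y ω < f (V ω)} = ∫⁻ ω, {ω | V ω ∈ A ∧ -Y ω < f (V ω)}.indicator
      (fun ω ↦ ENNReal.ofReal (Real.exp (-(2 * c * Y ω)))) ω ∂P := by
  have hlaw := (indepFun_iff_map_prod_eq_prod_map_map hV hY.aemeasurable).1 hVY
  rw [hY.map_eq] at hlaw
  have : IsProbabilityMeasure (P.map V) := Measure.isProbabilityMeasure_map hV
  have hS : MeasurableSet {p : E × ℝ | p.1 ∈ A ∧ p.2 < f p.1} :=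
    (measurable_fst hA).inter (measurableSet_lt measurable_snd (hf.comp measurable_fst))
  have hS' : MeasurableSet {p : E × ℝ | p.1 ∈ A ∧ -p.2 < f p.1} :=
    (measurable_fst hA).inter (measurableSet_lt measurable_snd.neg (hf.comp measurable_fst))
  have hg : Measurable ({p : E × ℝ | p.1 ∈ A ∧ -p.2 < f p.1}.indicator
      (fun p ↦ ENNReal.ofReal (Real.exp (-(2 * c * p.2))))) :=
    Measurable.indicator (by fun_prop) hS'
  have hL : P {ω | V ω ∈ A ∧ Y ω < f (V ω)}
      = P.map (fun ω ↦ (V ω, Y ω)) {p : E × ℝ | p.1 ∈ A ∧ p.2 < f p.1} := by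
    rw [Measure.map_apply_of_aemeasurable (hV.prodMk hY.aemeasurable) hS]
    rfl
  have hR : ∫⁻ ω, {ω | V ω ∈ A ∧ -Y ω < f (V ω)}.indicator
      (fun ω ↦ ENNReal.ofReal (Real.exp (-(2 * c * Y ω)))) ω ∂P
      = ∫⁻ p, {p : E × ℝ | p.1 ∈ A ∧ -p.2 < f p.1}.indicator
        (fun p ↦ ENNReal.ofReal (Real.exp (-(2 * c * p.2)))) p ∂P.map (fun ω ↦ (V ω, Y ω)) := by
    rw [lintegral_map' hg.aemeasurable (hV.prodMk hY.aemeasurable)]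
    rfl
  rw [hL, hR, hlaw, Measure.prod_apply hS, lintegral_prod _ hg.aemeasurable]
  refine lintegral_congr fun v ↦ ?_
  rw [← lintegral_indicator_one (measurable_prodMk_left hS),
    lintegral_gaussianReal_drift_neg c s (measurable_one.indicator (measurable_prodMk_left hS))]
  refine lintegral_congr fun y ↦ ?_
  by_cases h : v ∈ A ∧ -y < f v <;> simp [indicator, h]

/-- The sequences whose first entry at or above the level `x` has index `k`. -/
def firstPassageSet (x : ℝ) (k : ℕ) : Set (ℕ → ℝ) := {z | x ≤ z k ∧ ∀ j < k, z j < x}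

lemma measurableSet_firstPassageSet (x : ℝ) (k : ℕ) : MeasurableSet (firstPassageSet x k) := by
  have : firstPassageSet x k = {z | x ≤ z k} ∩ ⋂ j ∈ Finset.range k, {z | z j < x} := by
    ext
    simp [firstPassageSet]
  rw [this]
  exact (measurableSet_le measurable_const (measurable_pi_apply k)).inter
    (Finset.measurableSet_biInter _ fun j _ ↦
      measurableSet_lt (measurable_pi_apply j) measurable_const)

lemma firstPassageSet_unique {x : ℝ} {k l : ℕ} {z : ℕ → ℝ} (hk : z ∈ firstPassageSet x k)
    (hl : z ∈ firstPassageSet x l) : k = l := by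
  rcases lt_trichotomy k l with h | h | h
  · exact absurd hk.1 (not_le.2 (hl.2 k h))
  · exact h
  · exact absurd hl.1 (not_le.2 (hk.2 l h))

lemma exists_mem_firstPassageSet {x : ℝ} {z : ℕ → ℝ} {n : ℕ} (h : x ≤ z n) :
    ∃ k ≤ n, z ∈ firstPassageSet x k := by
  classical
  have hex : ∃ k, x ≤ z k := ⟨n, h⟩
  exact ⟨Nat.find hex, Nat.find_min' hex h, Nat.find_spec hex,
    fun j hj ↦ not_le.1 (Nat.find_min hex hj)⟩

/-- The set of sequences which first reach the level `x` at index `k` and whose reflection after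
that index ends below `x` at index `n`. -/
def reflectedSet (x : ℝ) (n k : ℕ) : Set (ℕ → ℝ) :=
  {z | z ∈ firstPassageSet x k ∧ -(z n - z k) < x - z k}

lemma measurableSet_reflectedSet (x : ℝ) (n k : ℕ) : MeasurableSet (reflectedSet x n k) :=
  (measurableSet_firstPassageSet x k).inter (measurableSet_lt
    ((measurable_pi_apply n).sub (measurable_pi_apply k)).neg
    (measurable_const.sub (measurable_pi_apply k)))

/-- The likelihood ratio of the reflected sequences. -/
noncomputable def reflectionWeight (c x : ℝ) (n : ℕ) (z : ℕ → ℝ) : ENNReal :=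
  ∑ k ∈ Finset.range (n + 1),
    (reflectedSet x n k).indicator (fun z ↦ ENNReal.ofReal (Real.exp (-(2 * c * (z n - z k))))) z

lemma measurable_reflectionWeight (c x : ℝ) (n : ℕ) : Measurable (reflectionWeight c x n) := by
  refine Finset.measurable_fun_sum _ fun k _ ↦ Measurable.indicator ?_
    (measurableSet_reflectedSet x n k)
  fun_prop

lemma reflectionWeight_eq {c x : ℝ} {n k : ℕ} {z : ℕ → ℝ} (hkn : k ≤ n)
    (hk : z ∈ firstPassageSet x k) :
    reflectionWeight c x n z = (reflectedSet x n k).indicator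
      (fun z ↦ ENNReal.ofReal (Real.exp (-(2 * c * (z n - z k))))) z := by
  refine Finset.sum_eq_single_of_mem k (Finset.mem_range.2 (by omega)) fun l _ hl ↦ ?_
  exact indicator_of_notMem (fun h ↦ hl (firstPassageSet_unique h.1 hk)) _

lemma reflectionWeight_eq_zero {c x : ℝ} {n : ℕ} {z : ℕ → ℝ} (h : z n < x) :
    reflectionWeight c x n z = 0 := by
  refine Finset.sum_eq_zero fun k _ ↦ indicator_of_notMem (fun hk ↦ ?_) _
  have h1 := hk.1.1
  have h2 := hk.2
  linarith

/-- At most one summand survives, and there `z n - z k > z k - x ≥ 0`. This bound supplies the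
domination as the grid is refined. -/
lemma reflectionWeight_le_one {c x : ℝ} (hc : 0 ≤ c) (n : ℕ) (z : ℕ → ℝ) :
    reflectionWeight c x n z ≤ 1 := by
  rcases lt_or_ge (z n) x with h | h
  · simp [reflectionWeight_eq_zero h]
  · obtain ⟨k, hkn, hk⟩ := exists_mem_firstPassageSet h
    rw [reflectionWeight_eq hkn hk]
    refine indicator_apply_le' (fun hr ↦ ?_) (fun _ ↦ zero_le_one)
    rw [ENNReal.ofReal_le_one, Real.exp_le_one_iff, neg_nonpos]
    have h1 := hk.1
    have h2 := hr.2
    have : 0 ≤ z n - z k := by linarith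
    positivity

lemma ProbabilityTheory.IsPreBrownianReal.hasLaw_drift_sub {Ω : Type*} [MeasurableSpace Ω]
    {P : Measure Ω} {W : ℝ≥0 → Ω → ℝ} (hW : IsPreBrownianReal W P) (c : ℝ) {s t : ℝ≥0}
    (hst : s ≤ t) :
    HasLaw (fun ω ↦ (c * t + W t ω) - (c * s + W s ω))
      (gaussianReal (c * (t - s : ℝ≥0)) (t - s)) P := by
  have h := gaussianReal_const_add (hW.hasLaw_sub t s) (c * (t - s : ℝ≥0))
  have hd : nndist (t : ℝ) (s : ℝ) = t - s := by
    ext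
    rw [coe_nndist, Real.dist_eq, abs_of_nonneg (sub_nonneg.2 (by exact_mod_cast hst)),
      NNReal.coe_sub hst]
  rw [zero_add] at h
  convert h using 1
  · funext ω
    simp only [Pi.sub_apply]
    rw [NNReal.coe_sub hst]
    ring
  · congr 1
    exact hd.symm

/-- The reflection principle for a Brownian motion with drift, observed at finitely many times. -/
lemma ProbabilityTheory.IsPreBrownianReal.measure_drift_lt_eq_add {Ω : Type*} [MeasurableSpace Ω]
    {P : Measure Ω} [IsProbabilityMeasure P]
    {W : ℝ≥0 → Ω → ℝ} (hW : IsPreBrownianReal W P) (c x : ℝ) {t : ℕ → ℝ≥0} (ht : Monotone t)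
    (n : ℕ) :
    P {ω | c * t n + W (t n) ω < x} = P {ω | ∀ k ≤ n, c * t k + W (t k) ω < x}
      + ∫⁻ ω, reflectionWeight c x n (fun k ↦ c * t k + W (t k) ω) ∂P := by
  set Z : ℕ → Ω → ℝ := fun k ω ↦ c * t k + W (t k) ω with hZdef
  have hZ : ∀ k, AEMeasurable (Z k) P := fun k ↦ (hW.aemeasurable (t k)).const_add _
  have hZpi : AEMeasurable (fun ω k ↦ Z k ω) P := aemeasurable_pi_iff.2 hZ
  have hterm : ∀ k ≤ n, P {ω | (fun j ↦ Z j ω) ∈ firstPassageSet x k ∧ Z n ω < x}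
      = ∫⁻ ω, (reflectedSet x n k).indicator
        (fun z ↦ ENNReal.ofReal (Real.exp (-(2 * c * (z n - z k))))) (fun j ↦ Z j ω) ∂P := by
    intro k hk
    have hle : t k ≤ t n := ht hk
    -- Stopping at `k` via `min j k` keeps only times up to `t k`, without affecting first passage
    -- at `k`.
    have hind : IndepFun (fun ω (j : ℕ) ↦ Z (min j k) ω) (fun ω ↦ Z n ω - Z k ω) P := by
      have h := (hW.indepFun_shift (t k)).symm.comp
        (φ := fun (p : Iic (t k) → ℝ) (j : ℕ) ↦
          c * t (min j k) + p ⟨t (min j k), ht (min_le_right j k)⟩)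
        (ψ := fun p : ℝ≥0 → ℝ ↦ c * t n - c * t k + p (t n - t k))
        (measurable_pi_iff.2 fun j ↦ (measurable_pi_apply _).const_add _)
        (measurable_const.add (measurable_pi_apply (t n - t k)))
      convert h using 1
      · rfl
      funext ω
      simp only [Function.comp_apply, add_tsub_cancel_of_le hle, hZdef]
      ring
    have hF : ∀ ω, (fun j ↦ Z (min j k) ω) ∈ firstPassageSet x k
        ↔ (fun j ↦ Z j ω) ∈ firstPassageSet x k := by
      intro ω
      simp only [firstPassageSet, mem_ofPred_eq, min_self]
      refine and_congr_right fun _ ↦ forall₂_congr fun j hj ↦ ?_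
      rw [min_eq_left hj.le]
    have h := hind.measure_lt_comp_eq_lintegral_reflection
      (aemeasurable_pi_iff.2 fun j ↦ hZ (min j k)) (hW.hasLaw_drift_sub c hle)
      (measurableSet_firstPassageSet x k) (f := fun v ↦ x - v k)
      (measurable_const.sub (measurable_pi_apply k))
    simp only [hF, min_self, sub_lt_sub_iff_right] at h
    exact h
  have hR : ∫⁻ ω, reflectionWeight c x n (fun k ↦ Z k ω) ∂P
      = P {ω | (∃ k ≤ n, x ≤ Z k ω) ∧ Z n ω < x} := by
    have hset : {ω | (∃ k ≤ n, x ≤ Z k ω) ∧ Z n ω < x} = ⋃ k ∈ Finset.range (n + 1),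
        {ω | (fun j ↦ Z j ω) ∈ firstPassageSet x k ∧ Z n ω < x} := by
      ext ω
      simp only [mem_ofPred_eq, mem_iUnion, Finset.mem_range, exists_prop]
      constructor
      · rintro ⟨⟨k, hkn, hk⟩, hn⟩
        obtain ⟨l, hl, hlk⟩ := exists_mem_firstPassageSet (z := fun j ↦ Z j ω) hk
        exact ⟨l, by omega, hlk, hn⟩
      · rintro ⟨k, hk, hlk, hn⟩
        exact ⟨⟨k, by omega, hlk.1⟩, hn⟩
    rw [hset, measure_biUnion_finset₀]
    · simp only [reflectionWeight]
      rw [lintegral_finsetSum']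
      · exact Finset.sum_congr rfl fun k hk ↦
          (hterm k (Nat.lt_succ_iff.1 (Finset.mem_range.1 hk))).symm
      · intro k _
        refine Measurable.comp_aemeasurable (Measurable.indicator ?_
          (measurableSet_reflectedSet x n k)) hZpi
        fun_prop
    · intro k _ l _ hkl
      refine Disjoint.aedisjoint (disjoint_left.2 fun ω h1 h2 ↦ hkl ?_)
      exact firstPassageSet_unique h1.1 h2.1
    · intro k _
      exact (hZpi.nullMeasurable (measurableSet_firstPassageSet x k)).inter
        (nullMeasurableSet_lt (hZ n) aemeasurable_const)
  have hall : NullMeasurableSet {ω | ∀ k ≤ n, Z k ω < x} P := by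
    have : {ω | ∀ k ≤ n, Z k ω < x} = ⋂ k ∈ Finset.range (n + 1), {ω | Z k ω < x} := by
      ext
      simp
    rw [this]
    exact Finset.nullMeasurableSet_biInter _ fun k _ ↦ nullMeasurableSet_lt (hZ k) aemeasurable_const
  rw [hR, ← measure_inter_add_sdiff₀ _ hall]
  congr 2
  · ext ω
    simp only [mem_inter_iff, mem_ofPred_eq]
    exact ⟨fun h ↦ h.2, fun h ↦ ⟨h n le_rfl, h⟩⟩
  · ext ω
    simp only [Set.mem_sdiff, mem_ofPred_eq, not_forall, not_lt, exists_prop]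
    exact and_comm

/-! ### Refining the grid -/

/-- The points `δ k / n` of the uniform grid on `[0, δ]`. -/
noncomputable def uniformGrid (δ : ℝ≥0) (n k : ℕ) : ℝ≥0 := δ * k / n

lemma monotone_uniformGrid (δ : ℝ≥0) (n : ℕ) : Monotone (uniformGrid δ n) := by
  intro k l hkl
  unfold uniformGrid
  gcongr

@[simp]
lemma uniformGrid_self (δ : ℝ≥0) {n : ℕ} (hn : n ≠ 0) : uniformGrid δ n n = δ := by
  have : (n : ℝ≥0) ≠ 0 := by exact_mod_cast hn
  unfold uniformGrid
  field_simp

lemma uniformGrid_mem_Icc (δ : ℝ≥0) {n k : ℕ} (hn : n ≠ 0) (hk : k ≤ n) :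
    uniformGrid δ n k ∈ Icc 0 δ :=
  ⟨zero_le, (monotone_uniformGrid δ n hk).trans_eq (uniformGrid_self δ hn)⟩

lemma dist_uniformGrid_succ (δ : ℝ≥0) (n k : ℕ) :
    dist (uniformGrid δ n (k + 1)) (uniformGrid δ n k) = δ / n := by
  rw [NNReal.dist_eq]
  simp only [uniformGrid, NNReal.coe_div, NNReal.coe_mul, NNReal.coe_natCast, Nat.cast_add,
    Nat.cast_one, NNReal.coe_add, NNReal.coe_one]
  rw [← sub_div, ← mul_sub, add_sub_cancel_left, mul_one, abs_of_nonneg (by positivity)]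

/-- First passage is not at index `0`, and the preceding grid value is below `x`; the overshoot is
thus at most one increment over a step `δ / n`, small by uniform continuity. -/
lemma tendsto_overshoot_uniformGrid {z : ℝ≥0 → ℝ} (hz : Continuous z) {x : ℝ} (h0 : z 0 < x)
    (δ : ℝ≥0) {κ : ℕ → ℕ} (hκ : ∀ n ≠ 0, κ n ≤ n ∧
      (fun j ↦ z (uniformGrid δ n j)) ∈ firstPassageSet x (κ n)) :
    Tendsto (fun n ↦ z (uniformGrid δ n (κ n))) atTop (𝓝 x) := by
  have huc : UniformContinuousOn z (Icc 0 δ) :=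
    isCompact_Icc.uniformContinuousOn_of_continuous hz.continuousOn
  rw [Metric.uniformContinuousOn_iff] at huc
  rw [Metric.tendsto_atTop]
  intro ε hε
  obtain ⟨d, hd, huc⟩ := huc ε hε
  have hlim : Tendsto (fun n : ℕ ↦ (δ : ℝ) / n) atTop (𝓝 0) :=
    tendsto_const_div_atTop_nhds_zero_nat _
  obtain ⟨N, hN⟩ := eventually_atTop.1 (hlim.eventually (gt_mem_nhds hd))
  refine ⟨max N 1, fun n hn ↦ ?_⟩
  have hn0 : n ≠ 0 := by
    have := (le_max_right N 1).trans hn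
    omega
  obtain ⟨hκn, hfp⟩ := hκ n hn0
  have hpos : κ n ≠ 0 := by
    intro h
    have := hfp.1
    simp only [h, uniformGrid, Nat.cast_zero, mul_zero, zero_div] at this
    linarith
  obtain ⟨m, hm⟩ := Nat.exists_eq_succ_of_ne_zero hpos
  rw [hm] at hfp hκn ⊢
  have h1 := hfp.1
  have h2 := hfp.2 m (Nat.lt_succ_self m)
  have h3 := huc _ (uniformGrid_mem_Icc δ hn0 hκn) _
    (uniformGrid_mem_Icc δ hn0 (Nat.le_of_succ_le hκn))
    ((dist_uniformGrid_succ δ n m).trans_lt (hN n ((le_max_left N 1).trans hn)))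
  rw [Real.dist_eq] at h3 ⊢
  have h4 := (abs_lt.1 h3).2
  rw [abs_of_nonneg (sub_nonneg.2 h1)]
  simp only [Nat.succ_eq_add_one] at *
  linarith

lemma tendsto_reflectionWeight_uniformGrid {z : ℝ≥0 → ℝ} (hz : Continuous z) {x : ℝ}
    (h0 : z 0 < x) (c : ℝ) {δ : ℝ≥0} (hδ : z δ ≠ x) :
    Tendsto (fun n ↦ reflectionWeight c x n (fun k ↦ z (uniformGrid δ n k))) atTop
      (𝓝 ((Ioi x).indicator (fun y ↦ ENNReal.ofReal (Real.exp (-(2 * c * (y - x))))) (z δ))) := by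
  rcases lt_or_gt_of_ne hδ with h | h
  · rw [indicator_of_notMem (by simpa using h.le)]
    refine tendsto_const_nhds.congr' ?_
    filter_upwards [eventually_ne_atTop 0] with n hn
    exact (reflectionWeight_eq_zero (by simpa [hn] using h)).symm
  · rw [indicator_of_mem (by simpa using h)]
    have hex : ∀ n, ∃ k, n ≠ 0 → k ≤ n ∧
        (fun j ↦ z (uniformGrid δ n j)) ∈ firstPassageSet x k := by
      intro n
      rcases eq_or_ne n 0 with rfl | hn
      · exact ⟨0, fun h ↦ absurd rfl h⟩
      · obtain ⟨k, hk⟩ := exists_mem_firstPassageSet (x := x)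
          (z := fun j ↦ z (uniformGrid δ n j)) (n := n) (by simpa [hn] using h.le)
        exact ⟨k, fun _ ↦ hk⟩
    choose κ hκ using hex
    have hlim := tendsto_overshoot_uniformGrid hz h0 δ hκ
    have hw : Tendsto (fun n ↦ ENNReal.ofReal
        (Real.exp (-(2 * c * (z δ - z (uniformGrid δ n (κ n))))))) atTop
        (𝓝 (ENNReal.ofReal (Real.exp (-(2 * c * (z δ - x)))))) := by
      refine (ENNReal.continuous_ofReal.tendsto _).comp ((Real.continuous_exp.tendsto _).comp ?_)
      exact ((hlim.const_sub (z δ)).const_mul (2 * c)).neg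
    refine hw.congr' ?_
    -- This is the inequality defining `reflectedSet`, rearranged; its left side tends to `x`.
    have hev : ∀ᶠ n in atTop, 2 * z (uniformGrid δ n (κ n)) - x < z δ :=
      ((hlim.const_mul 2).sub_const x).eventually (gt_mem_nhds (by linarith))
    filter_upwards [eventually_ne_atTop 0, hev] with n hn hlt
    obtain ⟨hk1, hk2⟩ := hκ n hn
    rw [reflectionWeight_eq hk1 hk2, indicator_of_mem]
    · simp [hn]
    · refine ⟨hk2, ?_⟩
      simp only [uniformGrid_self δ hn]
      linarith

lemma eventually_exists_lt_uniformGrid {z : ℝ≥0 → ℝ} (hz : Continuous z) {δ t : ℝ≥0} (hδ : δ ≠ 0)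
    (ht : t ≤ δ) {y : ℝ} (hy : y < z t) :
    ∀ᶠ n : ℕ in atTop, ∃ k ≤ n, y < z (uniformGrid δ n k) := by
  have hδ' : (0 : ℝ) < δ := by positivity
  have hlim : Tendsto (fun n : ℕ ↦ uniformGrid δ n ⌊(t / δ : ℝ) * n⌋₊) atTop (𝓝 t) := by
    rw [← NNReal.tendsto_coe]
    have h := ((tendsto_nat_floor_mul_div_atTop (a := (t / δ : ℝ)) (by positivity)).comp
      tendsto_natCast_atTop_atTop).const_mul (δ : ℝ)
    rw [mul_div_cancel₀ _ hδ'.ne'] at h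
    refine h.congr fun n ↦ ?_
    simp [uniformGrid, mul_div_assoc]
  filter_upwards [((hz.tendsto t).comp hlim).eventually (lt_mem_nhds hy)] with n hn
  refine ⟨_, Nat.floor_le_of_le ?_, hn⟩
  refine mul_le_of_le_one_left (by positivity) ?_
  rw [div_le_one hδ']
  exact_mod_cast ht

/-! ### Law of the maximum with drift -/

/-- The distribution function of the maximum over `[0, v]` of a Brownian motion with drift `c`. -/
noncomputable def driftMaxCdf (c : ℝ) (v : ℝ≥0) (x : ℝ) : ℝ :=
  (gaussianReal (c * v) v).real (Iio x)
    - Real.exp (2 * c * x) * (gaussianReal (c * v) v).real (Iio (-x))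

lemma differentiable_driftMaxCdf (c : ℝ) {v : ℝ≥0} (hv : v ≠ 0) :
    Differentiable ℝ (driftMaxCdf c v) := by
  have h : Differentiable ℝ fun x ↦ (gaussianReal (c * v) v).real (Iio x) :=
    fun x ↦ (hasDerivAt_gaussianReal_real_Iio (c * v) hv x).differentiableAt
  have h2 : Differentiable ℝ fun x ↦ (gaussianReal (c * v) v).real (Iio (-x)) :=
    h.comp differentiable_neg
  unfold driftMaxCdf
  fun_prop

/-- Source of `K`: the two density terms add up, and differentiating the exponential contributes `-2
c Ψ`. -/
lemma hasDerivAt_driftMaxCdf_zero (c : ℝ) {v : ℝ≥0} (hv : v ≠ 0) :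
    HasDerivAt (driftMaxCdf c v) (constK c v) 0 := by
  have h1 := hasDerivAt_gaussianReal_real_Iio (c * v) hv 0
  have h2 : HasDerivAt (fun x ↦ (gaussianReal (c * v) v).real (Iio (-x)))
      (-gaussianPDFReal (c * v) v 0) 0 := by
    have h := hasDerivAt_gaussianReal_real_Iio (c * v) hv (-0)
    have h' := h.comp (0 : ℝ) (hasDerivAt_neg (0 : ℝ))
    rw [neg_zero, mul_neg_one] at h'
    exact h'
  have h3 : HasDerivAt (fun x : ℝ ↦ Real.exp (2 * c * x)) (2 * c) 0 := by
    simpa using ((hasDerivAt_id (0 : ℝ)).const_mul (2 * c)).exp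
  refine (h1.sub (h3.mul h2)).congr_deriv ?_
  simp only [mul_zero, Real.exp_zero, neg_zero]
  rw [gaussianPDFReal_drift_zero c hv, gaussianReal_real_Iio_zero c hv, constK]
  ring

lemma driftMaxCdf_zero (c : ℝ) (v : ℝ≥0) : driftMaxCdf c v 0 = 0 := by
  simp [driftMaxCdf]

/-- The weight `exp(-2 c y)` is absorbed by reflecting back, which leaves the constant `exp(2 c x)`.
-/
lemma lintegral_indicator_Ioi_exp_gaussianReal (c x : ℝ) (v : ℝ≥0) :
    ∫⁻ y, (Ioi x).indicator (fun y ↦ ENNReal.ofReal (Real.exp (-(2 * c * (y - x))))) y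
      ∂gaussianReal (c * v) v
      = ENNReal.ofReal (Real.exp (2 * c * x)) * gaussianReal (c * v) v (Iio (-x)) := by
  rw [← lintegral_indicator_one measurableSet_Iio,
    lintegral_gaussianReal_drift_neg c v (measurable_one.indicator measurableSet_Iio),
    ← lintegral_const_mul']
  · refine lintegral_congr fun y ↦ ?_
    by_cases h : x < y
    · rw [indicator_of_mem (by simpa using h), indicator_of_mem (by simpa using h), Pi.one_apply,
        one_mul, ← ENNReal.ofReal_mul (Real.exp_pos _).le, ← Real.exp_add]
      congr 2
      ring
    · rw [indicator_of_notMem (by simpa using h), indicator_of_notMem (by simpa using h)]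
      simp
  · simp

namespace ProbabilityTheory.IsBrownianReal

variable {Ω : Type*} [MeasurableSpace Ω] {P : Measure Ω} [IsProbabilityMeasure P]
  {W : ℝ≥0 → Ω → ℝ}

lemma tendsto_measureReal_drift_lt_uniformGrid (hW : IsBrownianReal W P) {c : ℝ} (hc : 0 ≤ c)
    {δ : ℝ≥0} (hδ : δ ≠ 0) {x : ℝ} (hx : 0 < x) :
    Tendsto (fun n : ℕ ↦ P.real {ω | ∀ k ≤ n,
      c * uniformGrid δ n k + W (uniformGrid δ n k) ω < x}) atTop (𝓝 (driftMaxCdf c δ x)) := by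
  have hlaw : HasLaw (fun ω ↦ c * δ + W δ ω) (gaussianReal (c * δ) δ) P := by
    simpa using gaussianReal_const_add (hW.hasLaw_eval δ) (c * δ)
  have hne : ∀ᵐ ω ∂P, c * δ + W δ ω ≠ x := by
    have : NullSingletonClass (gaussianReal (c * δ) δ) := nullSingletonClass_gaussianReal hδ
    have h : ∀ᵐ y ∂gaussianReal (c * δ) δ, y ≠ x := by
      rw [ae_iff]
      simp [measure_singleton]
    rw [← hlaw.map_eq] at h
    exact ae_of_ae_map hlaw.aemeasurable h
  have hmeas : Measurable ((Ioi x).indicator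
      (fun y ↦ ENNReal.ofReal (Real.exp (-(2 * c * (y - x)))))) :=
    Measurable.indicator (by fun_prop) measurableSet_Ioi
  have hlim : Tendsto (fun n : ℕ ↦ ∫⁻ ω, reflectionWeight c x n
      (fun k ↦ c * uniformGrid δ n k + W (uniformGrid δ n k) ω) ∂P) atTop
      (𝓝 (ENNReal.ofReal (Real.exp (2 * c * x)) * gaussianReal (c * δ) δ (Iio (-x)))) := by
    rw [← lintegral_indicator_Ioi_exp_gaussianReal, ← hlaw.lintegral_comp hmeas.aemeasurable]
    refine tendsto_lintegral_of_dominated_convergence' (fun _ ↦ 1) (fun n ↦ ?_) (fun n ↦ ?_)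
      (by simp) ?_
    · exact (measurable_reflectionWeight c x n).comp_aemeasurable
        (aemeasurable_pi_iff.2 fun k ↦ (hW.aemeasurable _).const_add _)
    · exact Eventually.of_forall fun ω ↦ reflectionWeight_le_one hc n _
    · filter_upwards [hne, hW.cont, hW.eval_zero_ae_eq_zero] with ω h1 h2 h3
      exact tendsto_reflectionWeight_uniformGrid (z := fun t ↦ c * t + W t ω) (by fun_prop)
        (by simpa [h3] using hx) c h1
  have hfin : ENNReal.ofReal (Real.exp (2 * c * x)) * gaussianReal (c * δ) δ (Iio (-x)) ≠ ⊤ :=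
    ENNReal.mul_ne_top ENNReal.ofReal_ne_top (measure_ne_top _ _)
  have hlim' := ((ENNReal.tendsto_toReal hfin).comp hlim).const_sub
    ((gaussianReal (c * δ) δ).real (Iio x))
  rw [ENNReal.toReal_mul, ENNReal.toReal_ofReal (Real.exp_pos _).le] at hlim'
  refine hlim'.congr' ?_
  filter_upwards [eventually_ne_atTop 0] with n hn
  have h := hW.measure_drift_lt_eq_add c x (monotone_uniformGrid δ n) n
  rw [uniformGrid_self δ hn] at h
  have hP : P {ω | c * δ + W δ ω < x} = gaussianReal (c * δ) δ (Iio x) := by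
    rw [← hlaw.map_eq, Measure.map_apply_of_aemeasurable hlaw.aemeasurable measurableSet_Iio]
    rfl
  rw [hP] at h
  simp only [Function.comp_apply, measureReal_def, h]
  have hne := measure_ne_top (gaussianReal (c * δ) δ) (Iio x)
  rw [h, ENNReal.add_ne_top] at hne
  rw [ENNReal.toReal_add hne.1 hne.2, add_sub_cancel_right]

/-- The distribution of the maximum of a Brownian motion with drift. -/
theorem measureReal_max_drift_lt (hW : IsBrownianReal W P) {c : ℝ} (hc : 0 ≤ c)
    {δ : ℝ≥0} (hδ : δ ≠ 0) {M : Ω → ℝ} (hMm : AEMeasurable M P)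
    (hM : ∀ᵐ ω ∂P, IsLUB ((fun t : ℝ≥0 ↦ c * t + W t ω) '' Icc 0 δ) (M ω)) {x : ℝ} (hx : 0 < x) :
    P.real {ω | M ω < x} = driftMaxCdf c δ x := by
  have hcont := (differentiable_driftMaxCdf c hδ).continuous
  refine le_antisymm ?_ ?_
  · refine ge_of_tendsto (hW.tendsto_measureReal_drift_lt_uniformGrid hc hδ hx) ?_
    filter_upwards [eventually_ne_atTop 0] with n hn
    refine ENNReal.toReal_mono (measure_ne_top _ _) (measure_mono_ae ?_)
    filter_upwards [hM] with ω hω hlt k hk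
    exact (hω.1 (mem_image_of_mem _ (uniformGrid_mem_Icc δ hn hk))).trans_lt hlt
  -- The lower level `y` gives room: if `M ≥ x`, some time, hence eventually some grid point, has
  -- value above `y`. Continuity then lets `y ↑ x`.
  · have hlow : ∀ y ∈ Ioo 0 x, driftMaxCdf c δ y ≤ P.real {ω | M ω < x} := by
      intro y hy
      have hA : ∀ n : ℕ, NullMeasurableSet {ω | ∀ k ≤ n,
          c * uniformGrid δ n k + W (uniformGrid δ n k) ω < y} P := by
        intro n
        have : {ω | ∀ k ≤ n, c * uniformGrid δ n k + W (uniformGrid δ n k) ω < y}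
            = ⋂ k ∈ Finset.range (n + 1),
              {ω | c * uniformGrid δ n k + W (uniformGrid δ n k) ω < y} := by
          ext
          simp
        rw [this]
        exact Finset.nullMeasurableSet_biInter _ fun k _ ↦
          nullMeasurableSet_lt ((hW.aemeasurable _).const_add _) aemeasurable_const
      set A : ℕ → Set Ω := fun n ↦ {ω | ∀ k ≤ n,
          c * uniformGrid δ n k + W (uniformGrid δ n k) ω < y}
      have hB : NullMeasurableSet {ω | x ≤ M ω} P := nullMeasurableSet_le aemeasurable_const hMm
      have hzero : Tendsto (fun n ↦ P.real (A n ∩ {ω | x ≤ M ω})) atTop (𝓝 0) := by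
        have h : Tendsto (fun n ↦ ∫⁻ ω, (A n ∩ {ω | x ≤ M ω}).indicator 1 ω ∂P) atTop
            (𝓝 (∫⁻ _, 0 ∂P)) := by
          refine tendsto_lintegral_of_dominated_convergence' (fun _ ↦ 1)
            (fun n ↦ (aemeasurable_indicator_const_iff 1).2 ((hA n).inter hB))
            (fun n ↦ ?_) (by simp) ?_
          · exact Eventually.of_forall fun ω ↦ indicator_le_self' (fun _ _ ↦ zero_le_one) ω
          · filter_upwards [hM, hW.cont] with ω hω hct
            by_cases hxM : x ≤ M ω
            swap
            · simp [hxM]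
            obtain ⟨_, ⟨t, ht, rfl⟩, hyt, -⟩ := hω.exists_between (hy.2.trans_le hxM)
            refine tendsto_const_nhds.congr' ?_
            filter_upwards [eventually_exists_lt_uniformGrid (z := fun t : ℝ≥0 ↦ c * t + W t ω)
              (by fun_prop) hδ ht.2 hyt] with n hn
            obtain ⟨k, hk, hlt⟩ := hn
            exact (indicator_of_notMem (fun h ↦ (h.1 k hk).not_gt hlt) _).symm
        simp only [lintegral_zero] at h
        have h2 := (ENNReal.tendsto_toReal ENNReal.zero_ne_top).comp h
        refine h2.congr fun n ↦ ?_
        rw [Function.comp_apply, lintegral_indicator_one₀ ((hA n).inter hB), measureReal_def]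
      have hle : ∀ n, P.real (A n) ≤ P.real {ω | M ω < x} + P.real (A n ∩ {ω | x ≤ M ω}) := by
        intro n
        refine (measureReal_mono ?_).trans (measureReal_union_le _ _)
        intro ω hω
        rcases lt_or_ge (M ω) x with h | h
        · exact Or.inl h
        · exact Or.inr ⟨hω, h⟩
      have := le_of_tendsto_of_tendsto'
        (hW.tendsto_measureReal_drift_lt_uniformGrid hc hδ hy.1) (hzero.const_add _) hle
      simpa using this
    refine le_of_tendsto (hcont.continuousWithinAt (s := Iio x) (x := x)) ?_
    filter_upwards [Ioo_mem_nhdsLT hx] with y hy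
    exact hlow y hy

end ProbabilityTheory.IsBrownianReal

/-! ### Decomposition at `T₁` and conclusion -/

/-- A countable supremum makes `M` measurable, and a measurable function of the increments after
`T₁`. -/
lemma isLUB_image_ciSup_of_denseRange {X ι : Type*} [TopologicalSpace X] [Nonempty ι] {s : Set X}
    (hs : IsCompact s) {f : X → ℝ} (hf : Continuous f) {q : ι → s} (hq : DenseRange q) :
    IsLUB (f '' s) (⨆ i, f (q i)) := by
  obtain ⟨b, hb⟩ := (hs.image hf).bddAbove
  have hbdd : BddAbove (range fun i ↦ f (q i)) :=
    ⟨b, by rintro _ ⟨i, rfl⟩; exact hb (mem_image_of_mem f (q i).2)⟩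
  refine ⟨?_, fun a ha ↦ ?_⟩
  · rintro _ ⟨t, ht, rfl⟩
    have hcl : IsClosed {t : s | f t ≤ ⨆ i, f (q i)} :=
      isClosed_le (by fun_prop) continuous_const
    exact hq.induction_on (p := fun t : s ↦ f t ≤ ⨆ i, f (q i)) ⟨t, ht⟩ hcl
      fun i ↦ le_ciSup hbdd i
  · exact ciSup_le fun i ↦ ha (mem_image_of_mem f (q i).2)

lemma ProbabilityTheory.IndepFun.measureReal_lt_sub_eq_integral {Ω : Type*} [MeasurableSpace Ω]
    {P : Measure Ω} [IsProbabilityMeasure P] {X M : Ω → ℝ} (hXM : IndepFun X M P)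
    {m : ℝ} {v : ℝ≥0} (hv : v ≠ 0) (hX : HasLaw X (gaussianReal m v) P) (hM : AEMeasurable M P)
    (u : ℝ) :
    P.real {ω | u < X ω - M ω} = ∫ z, gaussianPDFReal m v (z + u) * P.real {ω | M ω < z} := by
  have hlaw := (indepFun_iff_map_prod_eq_prod_map_map hX.aemeasurable hM).1 hXM
  rw [hX.map_eq] at hlaw
  have : IsProbabilityMeasure (P.map M) := Measure.isProbabilityMeasure_map hM
  have hS : MeasurableSet {p : ℝ × ℝ | u < p.1 - p.2} :=
    measurableSet_lt measurable_const (by fun_prop)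
  have hF : ∀ z, P.real {ω | M ω < z} = (P.map M).real (Iio z) := by
    intro z
    rw [measureReal_def, measureReal_def, Measure.map_apply_of_aemeasurable hM measurableSet_Iio]
    rfl
  have h1 : P {ω | u < X ω - M ω} = ∫⁻ x, P.map M (Iio (x - u)) ∂gaussianReal m v := by
    have : P {ω | u < X ω - M ω} = P.map (fun ω ↦ (X ω, M ω)) {p : ℝ × ℝ | u < p.1 - p.2} := by
      rw [Measure.map_apply_of_aemeasurable (hX.aemeasurable.prodMk hM) hS]
      rfl
    rw [this, hlaw, Measure.prod_apply hS]
    refine lintegral_congr fun x ↦ ?_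
    congr 1
    ext y
    simp only [mem_preimage, mem_ofPred_eq, mem_Iio]
    exact lt_sub_comm
  have hmono : Measurable fun x ↦ P.map M (Iio (x - u)) :=
    Monotone.measurable fun x y hxy ↦ measure_mono (Iio_subset_Iio (by linarith))
  rw [measureReal_def, h1, ← integral_toReal hmono.aemeasurable
    (Eventually.of_forall fun x ↦ measure_lt_top _ _), integral_gaussianReal_eq_integral_smul hv,
    ← integral_add_right_eq_self _ u]
  refine integral_congr_ae (Eventually.of_forall fun z ↦ ?_)
  simp only [hF, add_sub_cancel_right, smul_eq_mul, measureReal_def]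

/-- Expand `(z + (u + c T))²`. -/
lemma gaussianPDFReal_neg_mul_add (c : ℝ) {T : ℝ≥0} (hT : T ≠ 0) (u z : ℝ) :
    gaussianPDFReal (-(c * T)) T (z + u)
      = stdNormalDensity ((u + c * T) / √(T : ℝ)) / √(T : ℝ)
        * Real.exp (-((u + c * T) / T * z) - z ^ 2 / (2 * T)) := by
  have hT' : (0 : ℝ) < T := by positivity
  have hs : (0 : ℝ) < √(T : ℝ) := Real.sqrt_pos.2 hT'
  simp only [stdNormalDensity, gaussianPDFReal_def, NNReal.coe_one, mul_one, sub_zero]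
  rw [Real.sqrt_mul (by positivity) (T : ℝ), mul_inv, mul_div_right_comm, div_eq_mul_inv,
    mul_assoc _ (Real.exp _) (Real.exp _), ← Real.exp_add]
  congr 2
  rw [div_pow, Real.sq_sqrt hT'.le]
  field_simp
  ring

/-- Near `0` the slope is below `K + 1`; beyond `d`, `F z ≤ 1 ≤ z / d`. This feeds the domination
hypothesis of the Abelian lemma. -/
lemma exists_forall_le_mul_of_tendsto_div {F : ℝ → ℝ} (hF : ∀ z, F z ≤ 1) {K : ℝ}
    (hK : Tendsto (fun z ↦ F z / z) (𝓝[>] 0) (𝓝 K)) : ∃ C, ∀ z, 0 < z → F z ≤ C * z := by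
  have hev : ∀ᶠ z in 𝓝[>] (0 : ℝ), F z / z < K + 1 := hK.eventually (gt_mem_nhds (by linarith))
  obtain ⟨d, hd, hlt⟩ := (mem_nhdsGT_iff_exists_Ioo_subset).1 hev
  have hd : 0 < d := hd
  refine ⟨max (K + 1) (1 / d), fun z hz ↦ ?_⟩
  rcases lt_or_ge z d with h | h
  · have h1 : F z / z < K + 1 := hlt ⟨hz, h⟩
    rw [div_lt_iff₀ hz] at h1
    exact h1.le.trans (by gcongr; exact le_max_left _ _)
  · calc F z ≤ 1 := hF z
      _ ≤ 1 / d * z := by rw [one_div_mul_eq_div]; exact (one_le_div hd).2 h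
      _ ≤ _ := by gcongr; exact le_max_right _ _

lemma ciInf_sub_drift_eq {b : ℝ≥0 → ℝ} {c M : ℝ} {T₁ T₂ : ℝ≥0} (hT : T₁ ≤ T₂)
    (hM : IsLUB ((fun s : ℝ≥0 ↦ c * s + -(b (T₁ + s) - b T₁)) '' Icc 0 (T₂ - T₁)) M) :
    ⨅ t : Icc T₁ T₂, (b t - c * ((t : ℝ≥0) : ℝ)) = (b T₁ - c * T₁) - M := by
  have : Nonempty (Icc T₁ T₂) := ⟨⟨T₁, le_rfl, hT⟩⟩
  refine IsGLB.ciInf_eq ⟨?_, fun a ha ↦ ?_⟩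
  · rintro _ ⟨⟨t, ht1, ht2⟩, rfl⟩
    have h := hM.1 (mem_image_of_mem _ (⟨zero_le, tsub_le_tsub_right ht2 T₁⟩ :
      t - T₁ ∈ Icc 0 (T₂ - T₁)))
    simp only [add_tsub_cancel_of_le ht1, NNReal.coe_sub ht1] at h
    simp only
    linarith
  · rw [le_sub_comm]
    refine hM.2 ?_
    rintro _ ⟨s, ⟨-, hs⟩, rfl⟩
    have h := ha ⟨⟨T₁ + s, le_self_add, by
      rw [add_comm]; exact (le_tsub_iff_right hT).1 hs⟩, rfl⟩
    simp only [NNReal.coe_add] at h ⊢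
    linarith

theorem theorem2p1 {Ω : Type*} [MeasurableSpace Ω] (P : Measure Ω) [IsProbabilityMeasure P]
    (B : ℝ≥0 → Ω → ℝ) (hB : IsBrownianReal B P)
    (c : ℝ) (hc : 0 < c) (T₁ T₂ : ℝ≥0) (hT₁ : 0 < T₁) (hT : T₁ < T₂) :
    (∀ y : ℝ, 0 < y → 0 < constK c y) ∧
    (fun u : ℝ ↦ P.real {ω | u < ⨅ t : Set.Icc T₁ T₂, (B t ω - c * ((t : ℝ≥0) : ℝ))})
      ~[atTop]
    (fun u : ℝ ↦ constK c ((T₂ : ℝ) - (T₁ : ℝ)) * ((T₁ : ℝ) / u)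
      * stdNormalTail ((u + c * (T₁ : ℝ)) / √(T₁ : ℝ))) := by
  refine ⟨fun y hy ↦ constK_pos hc hy, ?_⟩
  have hδ : T₂ - T₁ ≠ 0 := (tsub_pos_of_lt hT).ne'
  have hδcoe : ((T₂ - T₁ : ℝ≥0) : ℝ) = (T₂ : ℝ) - T₁ := NNReal.coe_sub hT.le
  set δ := T₂ - T₁
  rw [← hδcoe]
  set K := constK c δ
  have hK : 0 < K := constK_pos hc (by positivity)
  set W : ℝ≥0 → Ω → ℝ := fun s ω ↦ -(B (T₁ + s) ω - B T₁ ω)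
  have hW : IsBrownianReal W P := (hB.shift T₁).neg
  have : Nonempty (Icc 0 δ) := ⟨⟨0, le_rfl, zero_le⟩⟩
  set q := TopologicalSpace.denseSeq (Icc 0 δ)
  set M : Ω → ℝ := fun ω ↦ ⨆ i, (c * (q i : ℝ≥0) + W (q i) ω)
  have hMm : AEMeasurable M P := AEMeasurable.iSup fun i ↦ (hW.aemeasurable _).const_add _
  have hMlub : ∀ᵐ ω ∂P, IsLUB ((fun t : ℝ≥0 ↦ c * t + W t ω) '' Icc 0 δ) (M ω) := by
    filter_upwards [hW.cont] with ω hω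
    exact isLUB_image_ciSup_of_denseRange isCompact_Icc (f := fun t : ℝ≥0 ↦ c * t + W t ω)
      (by fun_prop) (TopologicalSpace.denseRange_denseSeq (Icc 0 δ))
  have hX : HasLaw (fun ω ↦ B T₁ ω - c * T₁) (gaussianReal (-(c * T₁)) T₁) P := by
    simpa using gaussianReal_sub_const (hB.hasLaw_eval T₁) (c * T₁)
  have hφ : Measurable fun p : Iic T₁ → ℝ ↦ p ⟨T₁, self_mem_Iic⟩ - c * T₁ := by fun_prop
  have hind : IndepFun (fun ω ↦ B T₁ ω - c * T₁) M P :=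
    (hB.indepFun_shift T₁).symm.comp hφ
      (ψ := fun p : ℝ≥0 → ℝ ↦ ⨆ i, (c * (q i : ℝ≥0) + -p (q i)))
      (Measurable.iSup fun i ↦ measurable_const.add (measurable_pi_apply _).neg)
  set F : ℝ → ℝ := fun z ↦ P.real {ω | M ω < z} with hFdef
  have hF_pos : ∀ z, 0 < z → F z = driftMaxCdf c δ z := fun z hz ↦
    hW.measureReal_max_drift_lt hc.le hδ hMm hMlub hz
  -- Almost surely `M` is at least the path's value `0` at time `0`.
  have hF_nonpos : ∀ z ≤ 0, F z = 0 := by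
    intro z hz
    rw [hFdef, measureReal_eq_zero_iff]
    refine measure_mono_null ?_ (ae_iff.1 (hMlub.and hW.eval_zero_ae_eq_zero))
    intro ω hω h
    have := h.1.1 (mem_image_of_mem _ (⟨le_rfl, zero_le⟩ : (0 : ℝ≥0) ∈ Icc 0 δ))
    have hω : M ω < z := hω
    simp only [h.2, NNReal.coe_zero, mul_zero, add_zero] at this
    linarith
  have hF_meas : Measurable F := Monotone.measurable fun x y hxy ↦
    measureReal_mono fun ω (hω : M ω < x) ↦ hω.trans_le hxy
  have hF_lim : Tendsto (fun z ↦ F z / z) (𝓝[>] 0) (𝓝 K) := by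
    have h := (hasDerivAt_driftMaxCdf_zero c hδ).hasDerivWithinAt (s := Ioi 0)
    rw [hasDerivWithinAt_iff_tendsto_slope' (by simp)] at h
    refine h.congr' ?_
    filter_upwards [self_mem_nhdsWithin] with z hz
    rw [slope_def_field, driftMaxCdf_zero, sub_zero, sub_zero, hF_pos z hz]
  obtain ⟨C, hC⟩ := exists_forall_le_mul_of_tendsto_div (fun z ↦ measureReal_le_one) hF_lim
  have hT₁' : (0 : ℝ) < T₁ := hT₁
  have hs : (0 : ℝ) < √(T₁ : ℝ) := Real.sqrt_pos.2 hT₁'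
  have hss : √(T₁ : ℝ) * √(T₁ : ℝ) = T₁ := Real.mul_self_sqrt hT₁'.le
  have habel := tendsto_pow_mul_integral_exp_neg_mul hT₁' 1 hF_meas (C := C) (L := K)
    (fun z hz ↦ by
      rw [abs_of_nonneg measureReal_nonneg, pow_one]
      exact hC z hz)
    (by simpa using hF_lim)
  simp only [Nat.factorial_one, Nat.cast_one, mul_one, one_add_one_eq_two] at habel
  have hprob : ∀ u : ℝ,
      P.real {ω | u < ⨅ t : Set.Icc T₁ T₂, (B t ω - c * ((t : ℝ≥0) : ℝ))}
      = stdNormalDensity ((u + c * T₁) / √(T₁ : ℝ)) / √(T₁ : ℝ)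
        * ∫ z in Ioi 0, Real.exp (-((u + c * T₁) / T₁ * z) - z ^ 2 / (2 * T₁)) * F z := by
    intro u
    have h1 : P.real {ω | u < ⨅ t : Set.Icc T₁ T₂, (B t ω - c * ((t : ℝ≥0) : ℝ))}
        = P.real {ω | u < (B T₁ ω - c * T₁) - M ω} := by
      refine measureReal_congr ?_
      filter_upwards [hMlub] with ω hω
      have := ciInf_sub_drift_eq (b := fun t ↦ B t ω) hT.le hω
      exact congrArg (u < ·) this
    rw [h1, hind.measureReal_lt_sub_eq_integral hT₁.ne' hX hMm, ← integral_const_mul,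
      ← setIntegral_eq_integral_of_forall_compl_eq_zero (s := Ioi 0)]
    · refine integral_congr_ae (Eventually.of_forall fun z ↦ ?_)
      simp only [gaussianPDFReal_neg_mul_add c hT₁.ne', hFdef]
      ring
    · intro z hz
      rw [show P.real {ω | M ω < z} = 0 from hF_nonpos z (not_lt.1 hz), mul_zero]
  have hlin : Tendsto (fun u : ℝ ↦ u + c * T₁) atTop atTop :=
    tendsto_atTop_add_const_right _ _ tendsto_id
  have habel' := (habel.comp (hlin.atTop_div_const hT₁')).div_const K
  have hmills := (tendsto_mul_stdNormalTail_div.comp (hlin.atTop_div_const hs)).inv₀ one_ne_zero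
  have hratio : Tendsto (fun u : ℝ ↦ u / (u + c * T₁)) atTop (𝓝 1) := by
    have h := (hlin.inv_tendsto_atTop.const_mul (c * T₁)).const_sub 1
    rw [mul_zero, sub_zero] at h
    refine h.congr' ?_
    filter_upwards [eventually_gt_atTop 0] with u hu
    have : 0 < u + c * T₁ := by positivity
    rw [Pi.inv_apply]
    field_simp
    ring
  rw [div_self hK.ne'] at habel'
  refine isEquivalent_of_tendsto_one ?_
  -- With `x = (u + c T₁)/√T₁` and `I` the integral, the ratio of the two sides is `(a² I / K) ·
  -- (φ(x) / (x Ψ(x))) · (u / (u + c T₁))`.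
  have hprod := (habel'.mul hmills).mul hratio
  rw [inv_one, mul_one, mul_one] at hprod
  refine hprod.congr' ?_
  filter_upwards [eventually_gt_atTop 0] with u hu
  have hu' : 0 < u + c * T₁ := by positivity
  have hd := (stdNormalDensity_pos ((u + c * T₁) / √(T₁ : ℝ))).ne'
  have ht := (stdNormalTail_pos ((u + c * T₁) / √(T₁ : ℝ))).ne'
  simp only [Function.comp_apply, Pi.div_apply, hprob]
  generalize ∫ z in Ioi 0, Real.exp (-((u + c * T₁) / T₁ * z) - z ^ 2 / (2 * T₁)) * F z = I
  generalize stdNormalDensity ((u + c * T₁) / √(T₁ : ℝ)) = d at *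
  generalize stdNormalTail ((u + c * T₁) / √(T₁ : ℝ)) = t at *
  rw [← hss]
  field_simp
  rw [Real.sqrt_sq hs.le]
  ring
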